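/- Let $n, m \ge 0$ be integers, let $Q \in \mathbb{R}^{n\times n}$ be a symmetric matrix, $\alpha \in \mathbb{R}^n$, $g \in \mathbb{R}$, $A \in \mathbb{R}^{m \times n}$ and $b \in \mathbb{R}^m$, and suppose that the polyhedron $P = \{x \in \mathbb{R}^n : Ax \le b\}$ is bounded. Let $$S = \{x \in \mathbb{R}^n : x^\top Q x + \alpha^\top x = g,\ x \in P\}.$$ Then the convex hull $\mathrm{conv}(S)$ is second-order cone representable. Here a set $X \subseteq \mathbb{R}^n$ is called second-order cone representable if there are integers $p, k \ge 0$ and $m_1, \dots, m_k \ge 0$ and affine maps $F_j : \mathbb{R}^n \times \mathbb{R}^p \to \mathbb{R}^{m_j} \times \mathbb{R}$, $j = 1, \dots, k$, such that $$X = \{x \in \mathbb{R}^n : \text{there is } u \in \mathbb{R}^p \text{ with } F_j(x,u) \in L_{m_j} \text{ for all } j = 1, \dots, k\},$$ where $L_m = \{(y,t) \in \mathbb{R}^m \times \mathbb{R} : \|y\|_2 \le t\}$ is the second-order (Lorentz) cone. -/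

import Mathlib

open scoped Matrix

/-- The second-order (Lorentz) cone `{(y, t) ∈ ℝᵐ × ℝ : ‖y‖₂ ≤ t}`. For `m = 0` it is the
half-line `t ≥ 0`, so that linear inequalities are second-order cone constraints. -/
def secondOrderCone (m : ℕ) : Set (EuclideanSpace ℝ (Fin m) × ℝ) :=
  {z | ‖z.1‖ ≤ z.2}

/-- A set `X ⊆ ℝⁿ` is second-order cone representable if it is the projection onto `ℝⁿ` of a set
in some `ℝⁿ × ℝᵖ` that is described by finitely many second-order cone constraints, each of which
requires the value of an affine map to lie in a second-order cone. -/
def IsSOCRepresentable {n : ℕ} (X : Set (Fin n → ℝ)) : Prop :=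
  ∃ (p k : ℕ) (m : Fin k → ℕ)
    (F : ∀ j : Fin k, ((Fin n → ℝ) × (Fin p → ℝ)) →ᵃ[ℝ] (EuclideanSpace ℝ (Fin (m j)) × ℝ)),
    X = {x | ∃ u : Fin p → ℝ, ∀ j : Fin k, F j (x, u) ∈ secondOrderCone (m j)}

/-! The proof is an induction over the faces of P
(`socRepresentable_convexHull_inter_polyhedronFace`). If every point of the quadric on a face lies
on a line inside the quadric parallel to the face, following the line both ways reaches smaller
faces. The hull is then that of a finite union of bounded sets with representable hulls, hence
representable.

Otherwise some point x₀ lies on no such line. The form Q is then anisotropic, hence definite, on the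
directions of the face orthogonal to the gradient at x₀. By Finsler's lemma the equation on the face
becomes ‖Y x‖ = |T x| with Y, T affine, which splits into two branches ‖Y x‖ = ±T x.

A branch is D ∩ (K \ U), with D the face, K convex closed and U ⊆ K convex open. Its hull is D ∩ K ∩
conv(D \ U) by `convexHull_inter_diff`. The hull of D \ U is handled by the same induction: a
hyperplane through a point outside U and missing U supplies the lines, unless the face has dimension
at most one. -/

/-- Second-order cone representability of a set in an arbitrary real vector space. -/
def SOCRepresentable {E : Type*} [AddCommGroup E] [Module ℝ E] (X : Set E) : Prop :=
  ∃ (p k : ℕ) (m : Fin k → ℕ)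
    (F : ∀ j : Fin k, (E × (Fin p → ℝ)) →ᵃ[ℝ] (EuclideanSpace ℝ (Fin (m j)) × ℝ)),
    X = {x | ∃ u : Fin p → ℝ, ∀ j : Fin k, F j (x, u) ∈ secondOrderCone (m j)}

theorem secondOrderCone_add {m : ℕ} {y z : EuclideanSpace ℝ (Fin m) × ℝ}
    (hy : y ∈ secondOrderCone m) (hz : z ∈ secondOrderCone m) : y + z ∈ secondOrderCone m :=
  (norm_add_le _ _).trans (add_le_add hy hz)

theorem secondOrderCone_smul {m : ℕ} {y : EuclideanSpace ℝ (Fin m) × ℝ} {c : ℝ} (hc : 0 ≤ c)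
    (hy : y ∈ secondOrderCone m) : c • y ∈ secondOrderCone m := by
  change ‖c • y.1‖ ≤ c * y.2
  rw [norm_smul, Real.norm_of_nonneg hc]
  exact mul_le_mul_of_nonneg_left hy hc

/-! ### Closure properties of representable sets. -/

namespace SOCRepresentable

variable {E E' W : Type*} [AddCommGroup E] [Module ℝ E] [AddCommGroup E'] [Module ℝ E']
  [AddCommGroup W] [Module ℝ W]

theorem of_lift [FiniteDimensional ℝ W] {ι : Type*} [Finite ι] (m : ι → ℕ)
    (F : ∀ j, (E × W) →ᵃ[ℝ] (EuclideanSpace ℝ (Fin (m j)) × ℝ)) :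
    SOCRepresentable {x : E | ∃ u : W, ∀ j, F j (x, u) ∈ secondOrderCone (m j)} := by
  obtain ⟨k, ⟨e⟩⟩ := Finite.exists_equiv_fin ι
  let f : W ≃ₗ[ℝ] (Fin (Module.finrank ℝ W) → ℝ) := (Module.finBasis ℝ W).equivFun
  refine ⟨Module.finrank ℝ W, k, fun j => m (e.symm j), fun j => (F (e.symm j)).comp
    ((AffineMap.id ℝ E).prodMap f.symm.toLinearMap.toAffineMap), ?_⟩
  ext x
  constructor
  · rintro ⟨u, hu⟩
    exact ⟨f u, fun j => by simpa using hu (e.symm j)⟩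
  · rintro ⟨u, hu⟩
    refine ⟨f.symm u, fun j => ?_⟩
    obtain ⟨j, rfl⟩ := e.symm.surjective j
    simpa using hu j

theorem inter {X Y : Set E} (hX : SOCRepresentable X) (hY : SOCRepresentable Y) :
    SOCRepresentable (X ∩ Y) := by
  obtain ⟨p, k, m, F, rfl⟩ := hX
  obtain ⟨p', k', m', F', rfl⟩ := hY
  have h := of_lift (E := E) (W := (Fin p → ℝ) × (Fin p' → ℝ)) (Sum.elim m m')
    (fun j => Sum.rec
      (fun i => (F i).comp ((AffineMap.id ℝ E).prodMap
        (LinearMap.fst ℝ (Fin p → ℝ) (Fin p' → ℝ)).toAffineMap))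
      (fun i => (F' i).comp ((AffineMap.id ℝ E).prodMap
        (LinearMap.snd ℝ (Fin p → ℝ) (Fin p' → ℝ)).toAffineMap)) j)
  convert h using 1
  ext x
  constructor
  · rintro ⟨⟨u, hu⟩, ⟨v, hv⟩⟩
    refine ⟨(u, v), fun j => ?_⟩
    cases j with
    | inl i => exact hu i
    | inr i => exact hv i
  · rintro ⟨⟨u, v⟩, h⟩
    exact ⟨⟨u, fun j => h (Sum.inl j)⟩, ⟨v, fun j => h (Sum.inr j)⟩⟩

theorem preimage {Y : Set E'} (hY : SOCRepresentable Y) (G : E →ᵃ[ℝ] E') :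
    SOCRepresentable (G ⁻¹' Y) := by
  obtain ⟨p, k, m, F, rfl⟩ := hY
  exact ⟨p, k, m, fun j => (F j).comp (G.prodMap (AffineMap.id ℝ _)), rfl⟩

theorem exists_fiber [FiniteDimensional ℝ W] {Y : Set (E × W)} (hY : SOCRepresentable Y) :
    SOCRepresentable {x | ∃ w, (x, w) ∈ Y} := by
  obtain ⟨p, k, m, F, rfl⟩ := hY
  have h := of_lift (E := E) (W := W × (Fin p → ℝ)) m (fun j => (F j).comp
    (LinearEquiv.prodAssoc ℝ E W (Fin p → ℝ)).symm.toLinearMap.toAffineMap)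
  convert h using 1
  ext x
  constructor
  · rintro ⟨w, u, hu⟩
    exact ⟨(w, u), hu⟩
  · rintro ⟨⟨w, u⟩, hu⟩
    exact ⟨w, u, hu⟩

theorem cone_preimage {m : ℕ} (G : E →ᵃ[ℝ] EuclideanSpace ℝ (Fin m) × ℝ) :
    SOCRepresentable {x | ‖(G x).1‖ ≤ (G x).2} :=
  ⟨0, 1, fun _ => m, fun _ => G.comp (LinearMap.fst ℝ E (Fin 0 → ℝ)).toAffineMap, by
    ext x; exact ⟨fun h => ⟨0, fun _ => h⟩, fun ⟨_, h⟩ => h 0⟩⟩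

theorem nonneg (f : E →ᵃ[ℝ] ℝ) : SOCRepresentable {x | 0 ≤ f x} := by
  have h := cone_preimage ((0 : E →ᵃ[ℝ] EuclideanSpace ℝ (Fin 0)).prod f)
  simpa using h

theorem univ : SOCRepresentable (Set.univ : Set E) := by
  simpa using nonneg (0 : E →ᵃ[ℝ] ℝ)

theorem empty : SOCRepresentable (∅ : Set E) := by
  have h := nonneg (AffineMap.const ℝ E (-1 : ℝ))
  convert h using 1
  ext x
  simp

theorem iInter {ι : Type*} [Finite ι] {X : ι → Set E} (h : ∀ i, SOCRepresentable (X i)) :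
    SOCRepresentable (⋂ i, X i) := by
  have := Fintype.ofFinite ι
  classical
  have key : ∀ s : Finset ι, SOCRepresentable (⋂ i ∈ s, X i) := by
    intro s
    induction s using Finset.induction_on with
    | empty => simpa using univ
    | insert a s _ ih =>
      rw [Finset.set_biInter_insert]
      exact (h a).inter ih
  simpa using key Finset.univ

theorem eq_zero (f : E →ᵃ[ℝ] ℝ) : SOCRepresentable {x | f x = 0} := by
  convert (nonneg f).inter (nonneg (-f)) using 1
  ext x
  simp only [Set.mem_ofPred_eq, Set.mem_inter_iff, AffineMap.coe_neg, Pi.neg_apply]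
  constructor
  · intro h; simp [h]
  · rintro ⟨h1, h2⟩; linarith

end SOCRepresentable

/-! ### Homogenization and convex hulls of finite unions. -/

namespace SOCRepresentable

variable {E : Type*} [NormedAddCommGroup E] [NormedSpace ℝ E]

/-- Scaling the constant terms of the constraints by `z.2` homogenizes the description. Boundedness
makes the slice at height 0 collapse to the origin. -/
theorem cone_of_isBounded {X : Set E} (hX : SOCRepresentable X) (hne : X.Nonempty)
    (hb : Bornology.IsBounded X) :
    SOCRepresentable {z : E × ℝ | 0 ≤ z.2 ∧ ∃ x ∈ X, z.1 = z.2 • x} := by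
  obtain ⟨p, k, m, F, rfl⟩ := hX
  have hF : ∀ j z, F j z = (F j).linear z + F j 0 := fun j z => by
    simpa using (F j).map_vadd 0 z
  let H : ∀ j, ((E × ℝ) × (Fin p → ℝ)) →ₗ[ℝ] (EuclideanSpace ℝ (Fin (m j)) × ℝ) := fun j =>
    (F j).linear ∘ₗ ((LinearMap.fst ℝ E ℝ).prodMap LinearMap.id) +
      ((LinearMap.snd ℝ E ℝ) ∘ₗ (LinearMap.fst ℝ (E × ℝ) (Fin p → ℝ))).smulRight (F j 0)
  have hH : ∀ j x l u, H j ((x, l), u) = (F j).linear (x, u) + l • F j 0 := fun j x l u => rfl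
  have h := (of_lift (E := E × ℝ) (W := Fin p → ℝ) m (fun j => (H j).toAffineMap)).inter
    (nonneg (LinearMap.snd ℝ E ℝ).toAffineMap)
  convert h using 1
  ext ⟨x, l⟩
  simp only [Set.mem_ofPred_eq, Set.mem_inter_iff, LinearMap.coe_toAffineMap, hH,
    LinearMap.snd_apply]
  constructor
  · rintro ⟨hl, y, ⟨u, hu⟩, rfl⟩
    refine ⟨⟨l • u, fun j => ?_⟩, hl⟩
    have := secondOrderCone_smul hl (hu j)
    rw [hF, smul_add, ← map_smul] at this
    exact this
  · rintro ⟨⟨u, hu⟩, hl⟩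
    refine ⟨hl, ?_⟩
    rcases hl.eq_or_lt with rfl | hl
    · obtain ⟨y, v, hv⟩ := hne
      refine ⟨y, ⟨v, hv⟩, ?_⟩
      obtain ⟨C, hC⟩ := hb.exists_norm_le
      by_contra hx
      have hx0 : 0 < ‖x‖ := norm_pos_iff.2 (by simpa using hx)
      -- At height 0, `(x, u)` is a recession direction of the lifted set, so `x ≠ 0` would make X
      -- unbounded.
      have hmem : ∀ t : ℝ, 0 ≤ t → ‖y + t • x‖ ≤ C := fun t ht => by
        refine hC _ ⟨v + t • u, fun j => ?_⟩
        have h1 := secondOrderCone_add (hv j) (secondOrderCone_smul ht (hu j))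
        rw [zero_smul, add_zero, hF, ← map_smul, add_right_comm, ← map_add] at h1
        rw [hF]
        exact h1
      have hC0 : 0 ≤ C := (norm_nonneg _).trans (hmem 0 le_rfl)
      have ht : 0 ≤ (C + ‖y‖ + 1) / ‖x‖ := by positivity
      have h2 := hmem _ ht
      have h3 : ‖((C + ‖y‖ + 1) / ‖x‖) • x‖ = C + ‖y‖ + 1 := by
        rw [norm_smul, Real.norm_of_nonneg ht]
        field_simp
      have h4 := norm_sub_norm_le (((C + ‖y‖ + 1) / ‖x‖) • x) (-y)
      rw [norm_neg, sub_neg_eq_add, add_comm _ y] at h4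
      linarith
    · refine ⟨l⁻¹ • x, ⟨l⁻¹ • u, fun j => ?_⟩, by rw [smul_inv_smul₀ hl.ne']⟩
      have := secondOrderCone_smul (inv_nonneg.2 hl.le) (hu j)
      rw [smul_add, inv_smul_smul₀ hl.ne', ← map_smul] at this
      rw [hF]
      exact this

/-- The products `a • x` and `(1 - a) • y` are not affine in the unknowns. Replacing them by the
points `w` and `z - w` of the two homogenized cones removes the products. -/
theorem convexHull_union {X Y : Set E} [FiniteDimensional ℝ E]
    (hX : SOCRepresentable (convexHull ℝ X))
    (hY : SOCRepresentable (convexHull ℝ Y)) (hbX : Bornology.IsBounded X)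
    (hbY : Bornology.IsBounded Y) : SOCRepresentable (convexHull ℝ (X ∪ Y)) := by
  rcases X.eq_empty_or_nonempty with rfl | hneX
  · simpa using hY
  rcases Y.eq_empty_or_nonempty with rfl | hneY
  · simpa using hX
  have h1 := (hX.cone_of_isBounded hneX.convexHull
    (isBounded_convexHull.2 hbX)).preimage (LinearMap.snd ℝ E (E × ℝ)).toAffineMap
  have h2 := (hY.cone_of_isBounded hneY.convexHull
    (isBounded_convexHull.2 hbY)).preimage
      (((LinearMap.fst ℝ E (E × ℝ)).toAffineMap -
        ((LinearMap.fst ℝ E ℝ) ∘ₗ (LinearMap.snd ℝ E (E × ℝ))).toAffineMap).prod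
      (AffineMap.const ℝ _ (1 : ℝ) -
        ((LinearMap.snd ℝ E ℝ) ∘ₗ (LinearMap.snd ℝ E (E × ℝ))).toAffineMap))
  convert (h1.inter h2).exists_fiber using 1
  rw [_root_.convexHull_union hneX hneY]
  ext z
  simp only [mem_convexJoin, segment, Set.mem_ofPred_eq, Set.mem_inter_iff, Set.mem_preimage,
    Prod.exists]
  constructor
  · rintro ⟨x, hx, y, hy, a, c, ha, hc, hac, rfl⟩
    refine ⟨a • x, a, ⟨ha, x, hx, rfl⟩, ?_, y, hy, ?_⟩
    · change 0 ≤ 1 - a; linarith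
    · change a • x + c • y - a • x = (1 - a) • y
      rw [← hac]; simp
  · rintro ⟨w, a, ⟨ha, x, hx, h1⟩, hc, y, hy, h2⟩
    change w = a • x at h1
    change 0 ≤ 1 - a at hc
    change z - w = (1 - a) • y at h2
    refine ⟨x, hx, y, hy, a, 1 - a, ha, hc, by ring, ?_⟩
    rw [← h1, ← h2]; abel

theorem convexHull_biUnion [FiniteDimensional ℝ E] {ι : Type*} (s : Finset ι) {X : ι → Set E}
    (h : ∀ i ∈ s, SOCRepresentable (convexHull ℝ (X i)))
    (hb : ∀ i ∈ s, Bornology.IsBounded (X i)) :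
    SOCRepresentable (convexHull ℝ (⋃ i ∈ s, X i)) := by
  classical
  induction s using Finset.induction_on with
  | empty => simpa using empty
  | insert a s _ ih =>
    rw [Finset.set_biUnion_insert]
    simp only [Finset.mem_insert, forall_eq_or_imp] at h hb
    exact convexHull_union h.1 (ih h.2 hb.2) hb.1
      ((Bornology.isBounded_biUnion s.finite_toSet).2 hb.2)

theorem singleton [FiniteDimensional ℝ E] (a : E) : SOCRepresentable ({a} : Set E) := by
  let B := Module.finBasis ℝ E
  have h := iInter fun i => eq_zero ((B.coord i).toAffineMap - AffineMap.const ℝ E (B.coord i a))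
  convert h using 1
  ext x
  simp only [Set.mem_singleton_iff, Set.mem_iInter, Set.mem_ofPred_eq]
  constructor
  · rintro rfl i; simp
  · intro h
    refine B.ext_elem fun i => ?_
    simpa [sub_eq_zero] using h i

theorem segment [FiniteDimensional ℝ E] (a b : E) : SOCRepresentable (segment ℝ a b) := by
  rw [← convexHull_pair, ← Set.singleton_union]
  exact convexHull_union (by simpa using singleton a) (by simpa using singleton b)
    Bornology.isBounded_singleton Bornology.isBounded_singleton

end SOCRepresentable

/-! ### Faces of a polytope and induction over them. -/

section Faces

variable {n m : ℕ}

/-- The points of the polyhedron `A x ≤ b` at which the constraints in `I` are tight. -/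
def polyhedronFace (A : Matrix (Fin m) (Fin n) ℝ) (b : Fin m → ℝ) (I : Finset (Fin m)) :
    Set (Fin n → ℝ) :=
  {x | A *ᵥ x ≤ b ∧ ∀ i ∈ I, (A *ᵥ x) i = b i}

variable {A : Matrix (Fin m) (Fin n) ℝ} {b : Fin m → ℝ}

theorem polyhedronFace_subset (I : Finset (Fin m)) :
    polyhedronFace A b I ⊆ {x | A *ᵥ x ≤ b} := fun _ h => h.1

theorem polyhedronFace_insert_subset [DecidableEq (Fin m)] (i : Fin m) (I : Finset (Fin m)) :
    polyhedronFace A b (insert i I) ⊆ polyhedronFace A b I := fun _ h =>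
  ⟨h.1, fun j hj => h.2 j (Finset.mem_insert_of_mem hj)⟩

theorem continuous_mulVec_apply (A : Matrix (Fin m) (Fin n) ℝ) (i : Fin m) :
    Continuous fun x : Fin n → ℝ => (A *ᵥ x) i :=
  (continuous_apply i).comp (Matrix.mulVecLin A).continuous_of_finiteDimensional

theorem polyhedronFace_eq_iInter (I : Finset (Fin m)) : polyhedronFace A b I =
    (⋂ i, {x | (A *ᵥ x) i ≤ b i}) ∩ ⋂ i : I, {x | (A *ᵥ x) i = b i} := by
  ext x
  simp [polyhedronFace, Pi.le_def]

theorem isClosed_polyhedronFace (I : Finset (Fin m)) : IsClosed (polyhedronFace A b I) := by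
  rw [polyhedronFace_eq_iInter]
  exact (isClosed_iInter fun i => isClosed_le (continuous_mulVec_apply A i) continuous_const).inter
    (isClosed_iInter fun i => isClosed_eq (continuous_mulVec_apply A i) continuous_const)

theorem convex_polyhedronFace (I : Finset (Fin m)) : Convex ℝ (polyhedronFace A b I) := by
  rw [polyhedronFace_eq_iInter]
  have hl : ∀ i, IsLinearMap ℝ fun x : Fin n → ℝ => (A *ᵥ x) i := fun i =>
    ⟨fun x y => by simp [Matrix.mulVec_add], fun c x => by simp [Matrix.mulVec_smul]⟩
  exact (convex_iInter fun i => convex_halfSpace_le (hl i) _).inter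
    (convex_iInter fun i => convex_hyperplane (hl i) _)

theorem socRepresentable_polyhedronFace (I : Finset (Fin m)) :
    SOCRepresentable (polyhedronFace A b I) := by
  rw [polyhedronFace_eq_iInter]
  let f : Fin m → (Fin n → ℝ) →ᵃ[ℝ] ℝ := fun i =>
    (LinearMap.proj i ∘ₗ Matrix.mulVecLin A).toAffineMap
  refine (SOCRepresentable.iInter fun i => ?_).inter (SOCRepresentable.iInter fun i => ?_)
  · convert SOCRepresentable.nonneg (AffineMap.const ℝ _ (b i) - f i) using 1
    ext x
    simp [f]
  · convert SOCRepresentable.eq_zero (f i - AffineMap.const ℝ _ (b i)) using 1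
    ext x
    simp [f, sub_eq_zero]

/-- A ray from a face of a bounded polyhedron, in a direction of the face, meets a smaller face. -/
theorem exists_mem_polyhedronFace_insert [DecidableEq (Fin m)]
    (hP : Bornology.IsBounded {x : Fin n → ℝ | A *ᵥ x ≤ b})
    {I : Finset (Fin m)} {x v : Fin n → ℝ} (hx : x ∈ polyhedronFace A b I) (hv : v ≠ 0)
    (hvI : ∀ i ∈ I, (A *ᵥ v) i = 0) :
    ∃ t : ℝ, 0 ≤ t ∧ ∃ i ∉ I, x + t • v ∈ polyhedronFace A b (insert i I) := by
  have hadd : ∀ (t : ℝ) i, (A *ᵥ (x + t • v)) i = (A *ᵥ x) i + t * (A *ᵥ v) i := fun t i => by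
    simp [Matrix.mulVec_add, Matrix.mulVec_smul]
  -- If no constraint increased along `v`, the whole ray would stay in the bounded polyhedron.
  have hne : (Finset.univ.filter fun i => 0 < (A *ᵥ v) i).Nonempty := by
    by_contra hcon
    rw [Finset.not_nonempty_iff_eq_empty, Finset.filter_eq_empty_iff] at hcon
    obtain ⟨C, hC⟩ := hP.exists_norm_le
    have hv0 : 0 < ‖v‖ := norm_pos_iff.2 hv
    have hmem : ∀ t : ℝ, 0 ≤ t → ‖x + t • v‖ ≤ C := fun t ht => hC _ fun i => by
      rw [hadd]
      have h1 := hx.1 i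
      have h2 := mul_nonpos_of_nonneg_of_nonpos ht (not_lt.1 (hcon (Finset.mem_univ i)))
      linarith
    have hC0 : 0 ≤ C := (norm_nonneg _).trans (hmem 0 le_rfl)
    have ht : 0 ≤ (C + ‖x‖ + 1) / ‖v‖ := by positivity
    have h2 := hmem _ ht
    have h3 : ‖((C + ‖x‖ + 1) / ‖v‖) • v‖ = C + ‖x‖ + 1 := by
      rw [norm_smul, Real.norm_of_nonneg ht]
      field_simp
    have h4 := norm_sub_norm_le (((C + ‖x‖ + 1) / ‖v‖) • v) (-x)
    rw [norm_neg, sub_neg_eq_add, add_comm _ x] at h4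
    linarith
  -- Ratio test: the first constraint to become tight along the ray.
  obtain ⟨i, hi, hmin⟩ := Finset.exists_min_image _ (fun i => (b i - (A *ᵥ x) i) / (A *ᵥ v) i) hne
  simp only [Finset.mem_filter, Finset.mem_univ, true_and] at hi hmin
  have ht : 0 ≤ (b i - (A *ᵥ x) i) / (A *ᵥ v) i := div_nonneg (sub_nonneg.2 (hx.1 i)) hi.le
  refine ⟨_, ht, i, fun hiI => hi.ne' (hvI i hiI), fun j => ?_, fun j hj => ?_⟩
  · rw [hadd]
    rcases le_or_gt ((A *ᵥ v) j) 0 with hj | hj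
    · have h1 := hx.1 j
      have h2 := mul_nonpos_of_nonneg_of_nonpos ht hj
      linarith
    · have h1 := (le_div_iff₀ hj).1 (hmin j hj)
      linarith
  · rw [hadd]
    rcases Finset.mem_insert.1 hj with rfl | hj
    · rw [div_mul_cancel₀ _ hi.ne']; ring
    · rw [hvI j hj, hx.2 j hj]; ring

theorem mem_convexHull_of_line {E : Type*} [AddCommGroup E] [Module ℝ E] {s : Set E} {x v : E}
    {t₁ t₂ : ℝ} (h₁ : 0 ≤ t₁) (h₂ : 0 ≤ t₂) (hx₁ : x + t₁ • v ∈ s) (hx₂ : x + t₂ • (-v) ∈ s) :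
    x ∈ convexHull ℝ s := by
  have hc : Convex ℝ ((AffineMap.lineMap x (x + v) : ℝ →ᵃ[ℝ] E) ⁻¹' convexHull ℝ s) :=
    (convex_convexHull ℝ s).affine_preimage _
  have h1 : t₁ ∈ (AffineMap.lineMap x (x + v) : ℝ →ᵃ[ℝ] E) ⁻¹' convexHull ℝ s := by
    apply subset_convexHull
    simpa [AffineMap.lineMap_apply, add_comm] using hx₁
  have h2 : -t₂ ∈ (AffineMap.lineMap x (x + v) : ℝ →ᵃ[ℝ] E) ⁻¹' convexHull ℝ s := by
    apply subset_convexHull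
    simpa [AffineMap.lineMap_apply, add_comm] using hx₂
  have h3 : (0 : ℝ) ∈ (AffineMap.lineMap x (x + v) : ℝ →ᵃ[ℝ] E) ⁻¹' convexHull ℝ s :=
    hc.ordConnected.out h2 h1 ⟨by linarith, h₁⟩
  simpa using h3

/-- If on every face either the hull of `X` is representable or every point of `X` lies on a line
in `X` that is parallel to the face, then the hulls of `X` on all faces are representable. -/
theorem socRepresentable_convexHull_inter_polyhedronFace
    (hP : Bornology.IsBounded {x : Fin n → ℝ | A *ᵥ x ≤ b}) (X : Set (Fin n → ℝ))
    (h : ∀ I, SOCRepresentable (convexHull ℝ (X ∩ polyhedronFace A b I)) ∨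
      ∀ x ∈ X ∩ polyhedronFace A b I, ∃ v ≠ 0, (∀ i ∈ I, (A *ᵥ v) i = 0) ∧
        ∀ t : ℝ, x + t • v ∈ X) (I : Finset (Fin m)) :
    SOCRepresentable (convexHull ℝ (X ∩ polyhedronFace A b I)) := by
  -- Each added tight constraint lowers the number of constraints outside `I`.
  induction hk : Iᶜ.card using Nat.strong_induction_on generalizing I with
  | _ k ih =>
  rcases h I with h | h
  · exact h
  have hrep : SOCRepresentable (convexHull ℝ
      (⋃ i ∈ Iᶜ, X ∩ polyhedronFace A b (insert i I))) := by
    refine SOCRepresentable.convexHull_biUnion _ (fun i hi => ?_)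
      (fun i _ => hP.subset (Set.inter_subset_right.trans (polyhedronFace_subset _)))
    refine ih _ ?_ _ rfl
    rw [← hk]
    refine Finset.card_lt_card ?_
    rw [Finset.compl_ssubset_compl]
    exact Finset.ssubset_insert (Finset.mem_compl.1 hi)
  convert hrep using 1
  refine (convexHull_min ?_ (convex_convexHull ℝ _)).antisymm (convexHull_mono ?_)
  · intro x hx
    obtain ⟨v, hv, hvI, hline⟩ := h x hx
    obtain ⟨t₁, ht₁, i₁, hi₁, h₁⟩ := exists_mem_polyhedronFace_insert hP hx.2 hv hvI
    obtain ⟨t₂, ht₂, i₂, hi₂, h₂⟩ := exists_mem_polyhedronFace_insert hP hx.2 (neg_ne_zero.2 hv)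
      (fun i hi => by rw [Matrix.mulVec_neg, Pi.neg_apply, hvI i hi, neg_zero])
    refine mem_convexHull_of_line ht₁ ht₂
      (Set.mem_biUnion (x := i₁) (by simpa using hi₁) ⟨hline t₁, h₁⟩)
      (Set.mem_biUnion (x := i₂) (by simpa using hi₂) ⟨?_, h₂⟩)
    simpa using hline (-t₂)
  · exact Set.iUnion₂_subset fun i _ =>
      Set.inter_subset_inter_right _ (polyhedronFace_insert_subset i I)

/-- The hull of a face of a polytope minus an open convex set is representable. -/
theorem socRepresentable_convexHull_compl_inter_polyhedronFace
    (hP : Bornology.IsBounded {x : Fin n → ℝ | A *ᵥ x ≤ b}) {U : Set (Fin n → ℝ)}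
    (hU : IsOpen U) (hUc : Convex ℝ U) (I : Finset (Fin m)) :
    SOCRepresentable (convexHull ℝ (Uᶜ ∩ polyhedronFace A b I)) := by
  refine socRepresentable_convexHull_inter_polyhedronFace hP _ (fun I => ?_) I
  -- Such an `f` is injective on the directions of the face, so the face has dimension at most one
  -- and the hull is the segment between the extreme points for `f`.
  by_cases hf : ∃ f : (Fin n → ℝ) →L[ℝ] ℝ, ∀ v, (∀ i ∈ I, (A *ᵥ v) i = 0) → f v = 0 → v = 0
  · left
    obtain ⟨f, hf⟩ := hf
    rcases (Uᶜ ∩ polyhedronFace A b I).eq_empty_or_nonempty with h0 | hne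
    · rw [h0, convexHull_empty]
      exact SOCRepresentable.empty
    have hcomp : IsCompact (Uᶜ ∩ polyhedronFace A b I) :=
      Metric.isCompact_of_isClosed_isBounded (hU.isClosed_compl.inter (isClosed_polyhedronFace I))
        (hP.subset (Set.inter_subset_right.trans (polyhedronFace_subset _)))
    obtain ⟨p, hp, hpmin⟩ := hcomp.exists_isMinOn hne f.continuous.continuousOn
    obtain ⟨q, hq, hqmax⟩ := hcomp.exists_isMaxOn hne f.continuous.continuousOn
    suffices h : convexHull ℝ (Uᶜ ∩ polyhedronFace A b I) = segment ℝ p q by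
      rw [h]
      exact SOCRepresentable.segment p q
    refine (convexHull_min (t := segment ℝ p q) ?_ (convex_segment (𝕜 := ℝ) p q)).antisymm
      (segment_subset_convexHull hp hq)
    intro z hz
    have hzI : f z ∈ segment ℝ (f p) (f q) := by
      have h1 : f p ≤ f z := hpmin hz
      have h2 : f z ≤ f q := hqmax hz
      rw [segment_eq_Icc (h1.trans h2)]
      exact ⟨h1, h2⟩
    obtain ⟨a, c, ha, hc, hac, hz'⟩ := hzI
    refine ⟨a, c, ha, hc, hac, ?_⟩
    rw [← sub_eq_zero]
    refine hf _ (fun i hi => ?_) ?_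
    · simp only [Matrix.mulVec_sub, Matrix.mulVec_add, Matrix.mulVec_smul, Pi.sub_apply,
        Pi.add_apply, Pi.smul_apply, hp.2.2 i hi, hq.2.2 i hi, hz.2.2 i hi, ← add_smul, hac]
      simp
    · rw [map_sub, map_add, map_smul, map_smul, hz', sub_self]
  · right
    push Not at hf
    rintro x ⟨hxU, -⟩
    -- A direction of the face in the kernel of `f` stays in a hyperplane through `x` that misses
    -- `U`.
    obtain ⟨f, hfx⟩ := geometric_hahn_banach_open_point hUc hU hxU
    obtain ⟨v, hvI, hfv, hv⟩ := hf f
    refine ⟨v, hv, hvI, fun t ht => ?_⟩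
    have := hfx _ ht
    simp [hfv] at this

/-- The part of a convex set between an open set and a closed set, and the hull of it. -/
theorem convexHull_inter_diff {E : Type*} [NormedAddCommGroup E] [NormedSpace ℝ E]
    {D K U : Set E} (hD : Convex ℝ D) (hK : Convex ℝ K) (hKc : IsClosed K) (hU : IsOpen U)
    (hUK : U ⊆ K) : convexHull ℝ (D ∩ (K \ U)) = (D ∩ K) ∩ convexHull ℝ (Uᶜ ∩ D) := by
  refine (Set.subset_inter (convexHull_min (t := D ∩ K) (fun x hx => ⟨hx.1, hx.2.1⟩)
    (hD.inter hK)) (convexHull_mono (t := Uᶜ ∩ D) fun x hx => ⟨hx.2.2, hx.1⟩)).antisymm ?_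
  rintro z ⟨⟨hzD, hzK⟩, hz⟩
  by_cases hzU : z ∈ U
  swap
  · exact subset_convexHull ℝ _ ⟨hzD, hzK, hzU⟩
  set C := convexHull ℝ (D ∩ (K \ U)) with hC
  have hCc : Convex ℝ C := convex_convexHull ℝ _
  -- This is the union of the open rays from `z` through the points of `C`. It contains `D \ U`,
  -- since a segment from `z ∈ U` to a point outside `U` meets `K \ U`. Being convex it contains
  -- `z`, which forces `z ∈ C`.
  have hconv : Convex ℝ {x | ∃ c ∈ C, ∃ s : ℝ, 0 < s ∧ x - z = s • (c - z)} := by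
    rintro x ⟨c, hc, s, hs, hx⟩ y ⟨d, hd, r, hr, hy⟩ a e ha he hae
    have hpos : 0 < a * s + e * r := by
      rcases ha.eq_or_lt with rfl | ha
      · have : e = 1 := by linarith
        subst this
        simpa using hr
      · have := mul_pos ha hs
        have := mul_nonneg he hr.le
        linarith
    refine ⟨(a * s / (a * s + e * r)) • c + (e * r / (a * s + e * r)) • d,
      hCc hc hd (by positivity) (by positivity) (by field_simp), _, hpos, ?_⟩
    have h1 : a • x + e • y - z = a • (x - z) + e • (y - z) := by
      have : z = (a + e) • z := by rw [hae, one_smul]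
      nth_rewrite 1 [this]
      module
    rw [h1, hx, hy, smul_sub (a * s + e * r), smul_add, smul_smul (a * s + e * r),
      smul_smul (a * s + e * r), mul_div_cancel₀ _ hpos.ne', mul_div_cancel₀ _ hpos.ne']
    module
  obtain ⟨c, hc, s, hs, h0⟩ : z ∈ {x | ∃ c ∈ C, ∃ s : ℝ, 0 < s ∧ x - z = s • (c - z)} := by
    refine convexHull_min ?_ hconv hz
    rintro x ⟨hxU, hxD⟩
    obtain ⟨y, hy, hyK⟩ : ∃ y ∈ segment ℝ z x, y ∈ K \ U := by
      by_contra hcon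
      push Not at hcon
      have hpre : IsPreconnected (segment ℝ z x) := (convex_segment z x).isPreconnected
      obtain ⟨y, -, hyU, hyK⟩ := hpre U Kᶜ hU hKc.isOpen_compl
        (fun y hy => by
          by_cases hyK : y ∈ K
          · left
            by_contra hyU
            exact hcon y hy ⟨hyK, hyU⟩
          · exact Or.inr hyK)
        ⟨z, left_mem_segment ℝ z x, hzU⟩
        ⟨x, right_mem_segment ℝ z x, fun hxK =>
          hcon x (right_mem_segment ℝ z x) ⟨hxK, hxU⟩⟩
      exact hyK (hUK hyU)
    have hyC : y ∈ C := subset_convexHull ℝ _ ⟨hD.segment_subset hzD hxD hy, hyK⟩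
    rw [segment_eq_image'] at hy
    obtain ⟨t, ht, rfl⟩ := hy
    have ht0 : 0 < t := ht.1.lt_of_ne fun h => hyK.2 (by simpa [← h] using hzU)
    exact ⟨_, hyC, t⁻¹, inv_pos.2 ht0, by rw [add_sub_cancel_left, inv_smul_smul₀ ht0.ne']⟩
  rw [sub_self, eq_comm, smul_eq_zero, or_iff_right hs.ne', sub_eq_zero] at h0
  exact h0 ▸ hc

theorem socRepresentable_convexHull_polyhedronFace_inter_norm_eq
    (hP : Bornology.IsBounded {x : Fin n → ℝ | A *ᵥ x ≤ b}) {k : ℕ}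
    (G : (Fin n → ℝ) →ᵃ[ℝ] EuclideanSpace ℝ (Fin k) × ℝ) (I : Finset (Fin m)) :
    SOCRepresentable (convexHull ℝ (polyhedronFace A b I ∩ {x | ‖(G x).1‖ = (G x).2})) := by
  have hG : Continuous G := G.continuous_of_finiteDimensional
  have hU : IsOpen {x | ‖(G x).1‖ < (G x).2} :=
    isOpen_lt (by fun_prop) (by fun_prop)
  have hK : IsClosed {x | ‖(G x).1‖ ≤ (G x).2} :=
    isClosed_le (by fun_prop) (by fun_prop)
  have hcU : Convex ℝ {x | ‖(G x).1‖ < (G x).2} := by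
    have h : Convex ℝ {z : EuclideanSpace ℝ (Fin k) × ℝ | ‖z.1‖ < z.2} := by
      simpa using (convexOn_univ_norm (E := EuclideanSpace ℝ (Fin k))).convex_strict_epigraph
    exact h.affine_preimage G
  have hcK : Convex ℝ {x | ‖(G x).1‖ ≤ (G x).2} := by
    have h : Convex ℝ {z : EuclideanSpace ℝ (Fin k) × ℝ | ‖z.1‖ ≤ z.2} := by
      simpa using (convexOn_univ_norm (E := EuclideanSpace ℝ (Fin k))).convex_epigraph
    exact h.affine_preimage G
  have heq : {x | ‖(G x).1‖ = (G x).2} =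
      {x | ‖(G x).1‖ ≤ (G x).2} \ {x | ‖(G x).1‖ < (G x).2} := by
    ext x
    simp [le_antisymm_iff]
  rw [heq, convexHull_inter_diff (convex_polyhedronFace I) hcK hK hU
    fun x (hx : ‖(G x).1‖ < (G x).2) => hx.le]
  exact ((socRepresentable_polyhedronFace I).inter (SOCRepresentable.cone_preimage G)).inter
    (socRepresentable_convexHull_compl_inter_polyhedronFace hP hU hcU I)

end Faces

/-! ### Quadratic forms and reduction of the quadric to cone boundaries. -/

section Quadratic

variable {n : ℕ}

theorem quadratic_apply_add {Q : Matrix (Fin n) (Fin n) ℝ} (hQ : Q.IsSymm) (α x v : Fin n → ℝ) :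
    (x + v) ⬝ᵥ Q *ᵥ (x + v) + α ⬝ᵥ (x + v) =
      x ⬝ᵥ Q *ᵥ x + α ⬝ᵥ x + ((2 : ℝ) • Q *ᵥ x + α) ⬝ᵥ v + v ⬝ᵥ Q *ᵥ v := by
  have h : x ⬝ᵥ Q *ᵥ v = Q *ᵥ x ⬝ᵥ v := by
    rw [Matrix.dotProduct_mulVec, ← Matrix.mulVec_transpose, hQ.eq]
  rw [Matrix.mulVec_add, add_dotProduct, dotProduct_add, dotProduct_add, dotProduct_add,
    add_dotProduct, smul_dotProduct, h, dotProduct_comm v (Q *ᵥ x), smul_eq_mul]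
  ring

/-- A quadratic form that is anisotropic on a subspace is definite on it. -/
theorem posDef_or_negDef_of_anisotropic {Q : Matrix (Fin n) (Fin n) ℝ} (hQ : Q.IsSymm)
    (V : Submodule ℝ (Fin n → ℝ)) (h : ∀ v ∈ V, v ≠ 0 → v ⬝ᵥ Q *ᵥ v ≠ 0) :
    (∀ v ∈ V, v ≠ 0 → 0 < v ⬝ᵥ Q *ᵥ v) ∨ (∀ v ∈ V, v ≠ 0 → v ⬝ᵥ Q *ᵥ v < 0) := by
  by_contra hcon
  push Not at hcon
  obtain ⟨⟨v, hv, hv0, hvQ⟩, u, hu, hu0, huQ⟩ := hcon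
  have hvQ' := hvQ.lt_of_ne (h v hv hv0)
  have huQ' := huQ.lt_of_ne' (h u hu hu0)
  have hexp : ∀ t : ℝ, (u + t • v) ⬝ᵥ Q *ᵥ (u + t • v) =
      (v ⬝ᵥ Q *ᵥ v) * (t * t) + (2 * (Q *ᵥ u ⬝ᵥ v)) * t + u ⬝ᵥ Q *ᵥ u := fun t => by
    have := quadratic_apply_add hQ 0 u (t • v)
    simp only [zero_dotProduct, add_zero, smul_dotProduct, dotProduct_smul, Matrix.mulVec_smul,
      smul_eq_mul] at this
    rw [this]; ring
  -- The leading and constant coefficients have opposite signs, so the form vanishes somewhere on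
  -- the line `u + t • v`. That point is nonzero, because the form is positive at `u` and
  -- nonpositive at multiples of `v`.
  obtain ⟨t, ht⟩ := exists_quadratic_eq_zero (a := v ⬝ᵥ Q *ᵥ v) (b := 2 * (Q *ᵥ u ⬝ᵥ v))
    (c := u ⬝ᵥ Q *ᵥ u) hvQ'.ne ⟨√(discrim (v ⬝ᵥ Q *ᵥ v) (2 * (Q *ᵥ u ⬝ᵥ v)) (u ⬝ᵥ Q *ᵥ u)), by
      rw [Real.mul_self_sqrt]
      unfold discrim
      nlinarith [sq_nonneg (2 * (Q *ᵥ u ⬝ᵥ v)), mul_pos_of_neg_of_neg hvQ' (neg_lt_zero.2 huQ')]⟩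
  rw [← hexp] at ht
  refine h _ (V.add_mem hu (V.smul_mem t hv)) (fun h0 => ?_) ht
  rw [add_eq_zero_iff_eq_neg] at h0
  rw [h0] at huQ'
  simp only [Matrix.mulVec_neg, Matrix.mulVec_smul, neg_dotProduct, dotProduct_neg,
    smul_dotProduct, dotProduct_smul, smul_eq_mul] at huQ'
  nlinarith [mul_nonneg (mul_self_nonneg t) (neg_nonneg.2 hvQ)]

/-- **Finsler's lemma**: a quadratic form that is positive definite on the kernel of `C` becomes a
sum of squares after adding a multiple of `‖C v‖²`. -/
theorem exists_add_mul_eq_sum_sq {κ : Type*} [Fintype κ] {Q : Matrix (Fin n) (Fin n) ℝ}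
    (hQ : Q.IsSymm) (C : Matrix κ (Fin n) ℝ)
    (h : ∀ v ≠ 0, C *ᵥ v = 0 → 0 < v ⬝ᵥ Q *ᵥ v) :
    ∃ (μ : ℝ) (k : ℕ) (u : Fin k → Fin n → ℝ), ∀ v,
      v ⬝ᵥ Q *ᵥ v + μ * (C *ᵥ v ⬝ᵥ C *ᵥ v) = ∑ i, (u i ⬝ᵥ v) ^ 2 := by
  have hCc : Continuous fun v => C *ᵥ v := (Matrix.mulVecLin C).continuous_of_finiteDimensional
  have hf : Continuous fun v : Fin n → ℝ => v ⬝ᵥ Q *ᵥ v :=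
    continuous_id.dotProduct (Matrix.mulVecLin Q).continuous_of_finiteDimensional
  have hg : Continuous fun v : Fin n → ℝ => C *ᵥ v ⬝ᵥ C *ᵥ v := hCc.dotProduct hCc
  have hg0 : ∀ v : Fin n → ℝ, 0 ≤ C *ᵥ v ⬝ᵥ C *ᵥ v := fun v =>
    Finset.sum_nonneg fun i _ => mul_self_nonneg _
  obtain ⟨μ, hμ⟩ : ∃ μ : ℝ, ∀ v ∈ Metric.sphere (0 : Fin n → ℝ) 1,
      0 ≤ v ⬝ᵥ Q *ᵥ v + μ * (C *ᵥ v ⬝ᵥ C *ᵥ v) := by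
    have hcomp : IsCompact (Metric.sphere (0 : Fin n → ℝ) 1 ∩ {v | v ⬝ᵥ Q *ᵥ v ≤ 0}) :=
      (isCompact_sphere _ _).inter_right (isClosed_le hf continuous_const)
    rcases Set.eq_empty_or_nonempty (Metric.sphere (0 : Fin n → ℝ) 1 ∩ {v | v ⬝ᵥ Q *ᵥ v ≤ 0})
      with h0 | hne
    · refine ⟨0, fun v hv => ?_⟩
      by_contra hlt
      have : v ∈ (∅ : Set (Fin n → ℝ)) := h0 ▸ ⟨hv, by
        rw [zero_mul, add_zero, not_le] at hlt
        exact hlt.le⟩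
      exact this
    · obtain ⟨p, hp, hpmin⟩ := hcomp.exists_isMinOn hne hf.continuousOn
      obtain ⟨q, hq, hqmin⟩ := hcomp.exists_isMinOn hne hg.continuousOn
      have hqpos : 0 < C *ᵥ q ⬝ᵥ C *ᵥ q := by
        refine (hg0 q).lt_of_ne fun h0 => ?_
        have hq0 : q ≠ 0 := by
          rintro rfl
          simpa using hq.1
        exact (h q hq0 (dotProduct_self_eq_zero.1 h0.symm)).not_ge hq.2
      have hp0 : p ⬝ᵥ Q *ᵥ p ≤ 0 := hp.2
      -- On the part of the sphere where the form is nonpositive, this μ balances the least value of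
      -- the form against the least value of `C *ᵥ v ⬝ᵥ C *ᵥ v`, which is positive there.
      have hμ0 : 0 ≤ -(p ⬝ᵥ Q *ᵥ p) / (C *ᵥ q ⬝ᵥ C *ᵥ q) :=
        div_nonneg (neg_nonneg.2 hp0) hqpos.le
      refine ⟨-(p ⬝ᵥ Q *ᵥ p) / (C *ᵥ q ⬝ᵥ C *ᵥ q), fun v hv => ?_⟩
      rcases le_or_gt (v ⬝ᵥ Q *ᵥ v) 0 with hv0 | hv0
      · have h1 : p ⬝ᵥ Q *ᵥ p ≤ v ⬝ᵥ Q *ᵥ v := hpmin ⟨hv, hv0⟩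
        have h2 : C *ᵥ q ⬝ᵥ C *ᵥ q ≤ C *ᵥ v ⬝ᵥ C *ᵥ v := hqmin ⟨hv, hv0⟩
        have h3 := mul_le_mul_of_nonneg_left h2 hμ0
        rw [div_mul_cancel₀ _ hqpos.ne'] at h3
        linarith
      · have := mul_nonneg hμ0 (hg0 v)
        linarith
  have hR : ∀ v : Fin n → ℝ, v ⬝ᵥ (Q + μ • (Cᵀ * C)) *ᵥ v =
      v ⬝ᵥ Q *ᵥ v + μ * (C *ᵥ v ⬝ᵥ C *ᵥ v) := fun v => by
    rw [Matrix.add_mulVec, dotProduct_add, Matrix.smul_mulVec, dotProduct_smul,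
      ← Matrix.mulVec_mulVec, Matrix.dotProduct_mulVec v Cᵀ, Matrix.vecMul_transpose, smul_eq_mul]
  have hpsd : (Q + μ • (Cᵀ * C)).PosSemidef := by
    refine Matrix.PosSemidef.of_dotProduct_mulVec_nonneg ?_ fun v => ?_
    · rw [Matrix.IsHermitian, Matrix.conjTranspose_eq_transpose_of_trivial, Matrix.transpose_add,
        Matrix.transpose_smul, Matrix.transpose_mul, Matrix.transpose_transpose, hQ.eq]
    · rw [star_trivial]
      rcases eq_or_ne v 0 with rfl | hv
      · simp
      have hv0 : ‖v‖ ≠ 0 := norm_ne_zero_iff.2 hv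
      have h1 := hμ (‖v‖⁻¹ • v) (by simp [norm_smul, hv0])
      rw [← hR] at h1
      rw [← smul_inv_smul₀ hv0 v, Matrix.mulVec_smul, smul_dotProduct, dotProduct_smul]
      exact mul_nonneg (norm_nonneg v) (mul_nonneg (norm_nonneg v) h1)
  obtain ⟨k, u, hu⟩ := Matrix.posSemidef_iff_eq_sum_vecMulVec.1 hpsd
  refine ⟨μ, k, u, fun v => ?_⟩
  rw [← hR, hu, Matrix.sum_mulVec, dotProduct_sum]
  refine Finset.sum_congr rfl fun i _ => ?_
  rw [star_trivial, Matrix.vecMulVec_mulVec, dotProduct_comm v]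
  simp [sq]

variable {m : ℕ} {A : Matrix (Fin m) (Fin n) ℝ} {b : Fin m → ℝ}

/-- The hull of a quadric on a face of a polytope is representable if at some point of it the
quadratic form is positive definite on the directions tangent to both. -/
theorem socRepresentable_convexHull_quadric_of_posDef
    (hP : Bornology.IsBounded {x : Fin n → ℝ | A *ᵥ x ≤ b})
    {Q : Matrix (Fin n) (Fin n) ℝ} (hQ : Q.IsSymm) (α : Fin n → ℝ) (g : ℝ) (I : Finset (Fin m))
    {x₀ : Fin n → ℝ} (hx₀ : x₀ ∈ polyhedronFace A b I)
    (hg : x₀ ⬝ᵥ Q *ᵥ x₀ + α ⬝ᵥ x₀ = g)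
    (hpos : ∀ v ≠ 0, (∀ i ∈ I, (A *ᵥ v) i = 0) → ((2 : ℝ) • Q *ᵥ x₀ + α) ⬝ᵥ v = 0 →
      0 < v ⬝ᵥ Q *ᵥ v) :
    SOCRepresentable (convexHull ℝ
      ({x | x ⬝ᵥ Q *ᵥ x + α ⬝ᵥ x = g} ∩ polyhedronFace A b I)) := by
  set w := (2 : ℝ) • Q *ᵥ x₀ + α with hw
  -- The rows are the gradient `w` and the tight constraints. Along the face only the row `w`
  -- contributes to `C *ᵥ v`.
  let C : Matrix (Option I) (Fin n) ℝ := Matrix.of fun o j => o.elim (w j) fun i => A i j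
  obtain ⟨μ, k, u, hu⟩ := exists_add_mul_eq_sum_sq hQ C (fun v hv hC => hpos v hv
      (fun i hi => congrFun hC (some ⟨i, hi⟩)) (congrFun hC none))
  have hu' : ∀ v, (∀ i ∈ I, (A *ᵥ v) i = 0) →
      v ⬝ᵥ Q *ᵥ v + μ * (w ⬝ᵥ v) ^ 2 = ∑ i, (u i ⬝ᵥ v) ^ 2 := fun v hv => by
    have hC : C *ᵥ v ⬝ᵥ C *ᵥ v = (w ⬝ᵥ v) ^ 2 := by
      rw [dotProduct, Fintype.sum_option, Finset.sum_eq_zero, add_zero, sq]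
      · rfl
      · rintro ⟨i, hi⟩ -
        exact mul_eq_zero_of_left (hv i hi) _
    rw [← hu v, hC]
  let L : (Fin n → ℝ) → (Fin n → ℝ) →ᵃ[ℝ] ℝ := fun c =>
    (dotProductBilin ℝ ℝ c).toAffineMap - AffineMap.const ℝ _ (c ⬝ᵥ x₀)
  have hL : ∀ c x, L c x = c ⬝ᵥ (x - x₀) := fun c x => by
    rw [dotProduct_sub]; rfl
  -- With s = w ⬝ᵥ (x - x₀), the equation on the face reads ∑ (uᵢ ⬝ᵥ (x - x₀))² = μs² - s. The
  -- identity 4(μs² - s) = ((1 + μ)s - 1)² - ((1 - μ)s + 1)² turns it into ‖Y x‖² = (T x)², for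
  -- either sign of μ.
  let Y : (Fin n → ℝ) →ᵃ[ℝ] EuclideanSpace ℝ (Fin (k + 1)) :=
    (WithLp.linearEquiv 2 ℝ (Fin (k + 1) → ℝ)).symm.toLinearMap.toAffineMap.comp
      (AffineMap.pi (Fin.cons ((1 - μ) • L w + AffineMap.const ℝ _ 1) fun i => (2 : ℝ) • L (u i)))
  let T : (Fin n → ℝ) →ᵃ[ℝ] ℝ := (1 + μ) • L w - AffineMap.const ℝ _ 1
  have hY : ∀ x, ‖Y x‖ ^ 2 = ((1 - μ) * (w ⬝ᵥ (x - x₀)) + 1) ^ 2 +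
      4 * ∑ i, (u i ⬝ᵥ (x - x₀)) ^ 2 := fun x => by
    rw [EuclideanSpace.norm_sq_eq, Fin.sum_univ_succ, Finset.mul_sum]
    congr 1
    · rw [Real.norm_eq_abs, sq_abs, ← hL]; rfl
    · refine Finset.sum_congr rfl fun i _ => ?_
      rw [Real.norm_eq_abs, sq_abs, ← hL]
      change (2 * L (u i) x) ^ 2 = _
      ring
  have hT : ∀ x, T x = (1 + μ) * (w ⬝ᵥ (x - x₀)) - 1 := fun x => by
    rw [← hL]; rfl
  have hset : {x | x ⬝ᵥ Q *ᵥ x + α ⬝ᵥ x = g} ∩ polyhedronFace A b I =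
      polyhedronFace A b I ∩ {x | ‖(Y.prod T x).1‖ = (Y.prod T x).2} ∪
      polyhedronFace A b I ∩ {x | ‖(Y.prod (-T) x).1‖ = (Y.prod (-T) x).2} := by
    rw [← Set.inter_union_distrib_left, Set.inter_comm]
    ext x
    refine and_congr_right fun hx => ?_
    change _ = _ ↔ ‖Y x‖ = T x ∨ ‖Y x‖ = -T x
    rw [← sq_eq_sq_iff_eq_or_eq_neg, hY, hT]
    have h1 := quadratic_apply_add hQ α x₀ (x - x₀)
    rw [add_sub_cancel, hg, ← hw] at h1
    have h2 := hu' (x - x₀) fun i hi => by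
      rw [Matrix.mulVec_sub, Pi.sub_apply, hx.2 i hi, hx₀.2 i hi, sub_self]
    rw [h1, ← h2]
    constructor <;> intro h <;> linarith
  have hb : ∀ X, Bornology.IsBounded (polyhedronFace A b I ∩ X) := fun X =>
    hP.subset (Set.inter_subset_left.trans (polyhedronFace_subset I))
  rw [hset]
  exact SOCRepresentable.convexHull_union
    (socRepresentable_convexHull_polyhedronFace_inter_norm_eq hP _ I)
    (socRepresentable_convexHull_polyhedronFace_inter_norm_eq hP _ I) (hb _) (hb _)

theorem socRepresentable_convexHull_quadric
    (hP : Bornology.IsBounded {x : Fin n → ℝ | A *ᵥ x ≤ b})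
    {Q : Matrix (Fin n) (Fin n) ℝ} (hQ : Q.IsSymm) (α : Fin n → ℝ) (g : ℝ) (I : Finset (Fin m)) :
    SOCRepresentable (convexHull ℝ
      ({x | x ⬝ᵥ Q *ᵥ x + α ⬝ᵥ x = g} ∩ polyhedronFace A b I)) := by
  refine socRepresentable_convexHull_inter_polyhedronFace hP _ (fun I => ?_) I
  refine or_iff_not_imp_right.2 fun hI => ?_
  push Not at hI
  obtain ⟨x₀, ⟨hg, hx₀⟩, hline⟩ := hI
  rw [Set.mem_ofPred_eq] at hg
  set w := (2 : ℝ) • Q *ᵥ x₀ + α with hw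
  let V : Submodule ℝ (Fin n → ℝ) :=
    { carrier := {v | (∀ i ∈ I, (A *ᵥ v) i = 0) ∧ w ⬝ᵥ v = 0}
      zero_mem' := by simp
      add_mem' := fun {x y} hx hy => ⟨fun i hi => by
        rw [Matrix.mulVec_add, Pi.add_apply, hx.1 i hi, hy.1 i hi, add_zero], by
        rw [dotProduct_add, hx.2, hy.2, add_zero]⟩
      smul_mem' := fun c x hx => ⟨fun i hi => by
        rw [Matrix.mulVec_smul, Pi.smul_apply, hx.1 i hi, smul_zero], by
        rw [dotProduct_smul, hx.2, smul_zero]⟩ }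
  -- Along an isotropic direction orthogonal to the gradient the quadratic function is constant, so
  -- the line through `x₀` would lie in the quadric.
  have hV : ∀ v ∈ V, v ≠ 0 → v ⬝ᵥ Q *ᵥ v ≠ 0 := by
    rintro v ⟨hvI, hvw⟩ hv0 hvQ
    obtain ⟨t, ht⟩ := hline v hv0 hvI
    apply ht
    rw [Set.mem_ofPred_eq, quadratic_apply_add hQ, hg, ← hw]
    simp [Matrix.mulVec_smul, hvw, hvQ]
  rcases posDef_or_negDef_of_anisotropic hQ V hV with h | h
  · exact socRepresentable_convexHull_quadric_of_posDef hP hQ α g I hx₀ hg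
      fun v hv hvI hvw => h v ⟨hvI, hvw⟩ hv
  -- Negating the equation exchanges the negative definite case for the positive definite one.
  · have hneg : ∀ x : Fin n → ℝ, x ⬝ᵥ (-Q) *ᵥ x + (-α) ⬝ᵥ x = -(x ⬝ᵥ Q *ᵥ x + α ⬝ᵥ x) :=
      fun x => by rw [Matrix.neg_mulVec, dotProduct_neg, neg_dotProduct, neg_add]
    have hrep := socRepresentable_convexHull_quadric_of_posDef hP hQ.neg (-α) (-g) I hx₀
      (by rw [hneg, hg]) fun v hv hvI hvw => by
        have : w ⬝ᵥ v = 0 := by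
          rw [← neg_eq_zero, ← neg_dotProduct, ← hvw, hw, Matrix.neg_mulVec, smul_neg, neg_add]
        rw [Matrix.neg_mulVec, dotProduct_neg]
        exact neg_pos.2 (h v ⟨hvI, this⟩ hv)
    simpa only [hneg, neg_inj] using hrep

end Quadratic

theorem theorem1 (n m : ℕ) (Q : Matrix (Fin n) (Fin n) ℝ) (hQ : Q.IsSymm)
    (α : Fin n → ℝ) (g : ℝ) (A : Matrix (Fin m) (Fin n) ℝ) (b : Fin m → ℝ)
    (hP : Bornology.IsBounded {x : Fin n → ℝ | A *ᵥ x ≤ b}) :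
    IsSOCRepresentable
      (convexHull ℝ {x : Fin n → ℝ | x ⬝ᵥ Q *ᵥ x + α ⬝ᵥ x = g ∧ A *ᵥ x ≤ b}) := by
  have h := socRepresentable_convexHull_quadric hP hQ α g ∅
  have hset : {x : Fin n → ℝ | x ⬝ᵥ Q *ᵥ x + α ⬝ᵥ x = g} ∩ polyhedronFace A b ∅ =
      {x : Fin n → ℝ | x ⬝ᵥ Q *ᵥ x + α ⬝ᵥ x = g ∧ A *ᵥ x ≤ b} := by
    ext x
    simp [polyhedronFace]
  rw [hset] at h
  exact h
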